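/- Let $\Bbbk$ be an algebraically closed field of characteristic $0$. Let $X$ be a finite set with $|X|=m\ge 2$ and let $r:X\times X\to X\times X$, $r(i,j)=(\sigma_i(j),\tau_j(i))$, be a bijection with $(r\times\mathrm{id})(\mathrm{id}\times r)(r\times\mathrm{id})=(\mathrm{id}\times r)(r\times\mathrm{id})(\mathrm{id}\times r)$, such that $r^2=\mathrm{id}$ and all maps $\sigma_i,\tau_i:X\to X$ are bijective (a non-degenerate involutive set-theoretic solution of the Yang–Baxter equation). Put $D(i)=\tau_i^{-1}(i)$ for $i\in X$. Let $R_{i,j}\in\Bbbk^\times$ $(i,j\in X)$ satisfy $$R_{i,j}\,R_{\tau_j(i),l}\,R_{\sigma_i(j),\sigma_{\tau_j(i)}(l)}=R_{j,l}\,R_{i,\sigma_j(l)}\,R_{\tau_{\sigma_j(l)}(i),\tau_l(j)}\qquad(i,j,l\in X),$$ so that $W_{X,r}=\bigoplus_{i\in X}\Bbbk w_i$ is a braided vector space with braiding $c(w_i\otimes w_j)=R_{i,j}\,w_{\sigma_i(j)}\otimes w_{\tau_j(i)}$. For a braided vector space $(V,c)$ let $c_n$ denote $\mathrm{id}^{\otimes(n-1)}\otimes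 c$ on $V^{\otimes(n+1)}$ and define $\mathfrak S_{0,1}=\mathrm{id}$, $\mathfrak S_{n,1}=\mathrm{id}+(\mathfrak S_{n-1,1}\otimes\mathrm{id})c_n\in\mathrm{End}(V^{\otimes(n+1)})$ for $n\ge1$, $\mathfrak S_0=\mathrm{id}$, $\mathfrak S_{n+1}=\mathfrak S_{n,1}(\mathfrak S_n\otimes\mathrm{id})\in\mathrm{End}(V^{\otimes(n+1)})$ for $n\ge0$, and $\mathfrak S=\bigoplus_n\mathfrak S_n$. The Nichols algebra is $\mathfrak B(V)=T(V)/\ker\mathfrak S$, where $\ker\mathfrak S$ is a two-sided ideal of the tensor algebra $T(V)$. Let $n\ge2$ and let $q\in\Bbbk$ be a primitive $n$-th root of unity. Assume that $R_{D(i),i}=q$ for all $i\in X$, and that $R_{i,j}R_{\sigma_i(j),\tau_j(i)}=1$ for all $i,j\in X$ with $i\ne D(j)$. Then $$\dim_\Bbbk\mathfrak B(W_{X,r})=n^m,$$ and $\mathfrak B(W_{X,r})$ is presented by the generators $w_i$ $(i\in X)$ and the relations $$w_iw_j-R_{i,j}\,w_{\sigma_i(j)}w_{\tau_j(i)}=0\quad(i,j\in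 X,\ D(j)\ne i),\qquad w_{D^{n-1}(i)}w_{D^{n-2}(i)}\cdots w_{D(i)}w_i=0\quad(i\in X);$$ that is, the kernel of the canonical map $T(W_{X,r})\to\mathfrak B(W_{X,r})$ is the two-sided ideal generated by the left-hand sides of these relations. -/

import Mathlib

noncomputable section

open scoped TensorProduct

namespace NicholsAlg

section TensorPowers

variable {k V : Type*} [Field k] [AddCommGroup V] [Module k V]

/-- The identification `V^{⊗n} ⊗ V ≃ V^{⊗(n+1)}` by concatenation. -/
def snocEquiv (k V : Type*) [Field k] [AddCommGroup V] [Module k V] (n : ℕ) :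
    (⨂[k]^n V) ⊗[k] V ≃ₗ[k] ⨂[k]^(n + 1) V :=
  (TensorProduct.congr (LinearEquiv.refl k (⨂[k]^n V))
    (PiTensorProduct.subsingletonEquiv (R := k) (0 : Fin 1)).symm).trans TensorPower.mulEquiv

/-- `f ⊗ id_V` as a map `V^{⊗(n+1)} → V^{⊗(m+1)}`, for `f : V^{⊗n} → V^{⊗m}`. -/
def tensorId {n m : ℕ} (f : (⨂[k]^n V) →ₗ[k] ⨂[k]^m V) :
    (⨂[k]^(n + 1) V) →ₗ[k] ⨂[k]^(m + 1) V :=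
  (snocEquiv k V m).toLinearMap ∘ₗ f.rTensor V ∘ₗ (snocEquiv k V n).symm.toLinearMap

/-- The identification `V^{⊗n} ⊗ (V ⊗ V) ≃ V^{⊗(n+2)}` by concatenation. -/
def snocTwoEquiv (k V : Type*) [Field k] [AddCommGroup V] [Module k V] (n : ℕ) :
    (⨂[k]^n V) ⊗[k] (V ⊗[k] V) ≃ₗ[k] ⨂[k]^(n + 2) V :=
  (TensorProduct.assoc k (⨂[k]^n V) V V).symm.trans
    ((TensorProduct.congr (snocEquiv k V n) (LinearEquiv.refl k V)).trans
      (snocEquiv k V (n + 1)))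

/-- `id ⊗ c` on `V^{⊗(n+2)} = V^{⊗n} ⊗ (V ⊗ V)`: the map `c` applied to the last two factors. -/
def applyLast (c : V ⊗[k] V →ₗ[k] V ⊗[k] V) (n : ℕ) :
    (⨂[k]^(n + 2) V) →ₗ[k] ⨂[k]^(n + 2) V :=
  (snocTwoEquiv k V n).toLinearMap ∘ₗ c.lTensor (⨂[k]^n V) ∘ₗ
    (snocTwoEquiv k V n).symm.toLinearMap

/-- The maps `𝔖_{n,1} ∈ End(V^{⊗(n+1)})`:
`𝔖_{0,1} = id` and `𝔖_{n+1,1} = id + (𝔖_{n,1} ⊗ id) c_{n+1}`. -/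
def shuffleSum (c : V ⊗[k] V →ₗ[k] V ⊗[k] V) :
    (n : ℕ) → (⨂[k]^(n + 1) V) →ₗ[k] ⨂[k]^(n + 1) V
  | 0 => LinearMap.id
  | n + 1 => LinearMap.id + tensorId (shuffleSum c n) ∘ₗ applyLast c n

/-- The quantum symmetrizers `𝔖_n ∈ End(V^{⊗n})`:
`𝔖_0 = id` and `𝔖_{n+1} = 𝔖_{n,1} (𝔖_n ⊗ id)`. -/
def symmetrizer (c : V ⊗[k] V →ₗ[k] V ⊗[k] V) :
    (n : ℕ) → (⨂[k]^n V) →ₗ[k] ⨂[k]^n V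
  | 0 => LinearMap.id
  | n + 1 => shuffleSum c n ∘ₗ tensorId (symmetrizer c n)

/-- The total quantum symmetrizer `𝔖 = ⨁ 𝔖_n`, as an endomorphism of the tensor algebra
`T(V) = ⨁ V^{⊗n}`. -/
def totalSymmetrizer (c : V ⊗[k] V →ₗ[k] V ⊗[k] V) :
    TensorAlgebra k V →ₗ[k] TensorAlgebra k V :=
  (TensorAlgebra.equivDirectSum (R := k) (M := V)).symm.toLinearMap ∘ₗ
    DirectSum.lmap (fun n => symmetrizer c n) ∘ₗ
      (TensorAlgebra.equivDirectSum (R := k) (M := V)).toLinearMap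

end TensorPowers

/-- A braiding on `V`: an automorphism `c` of `V ⊗ V` with
`(c ⊗ id)(id ⊗ c)(c ⊗ id) = (id ⊗ c)(c ⊗ id)(id ⊗ c)` on `V ⊗ V ⊗ V`. -/
structure Braiding (k V : Type*) [Field k] [AddCommGroup V] [Module k V] where
  c : V ⊗[k] V ≃ₗ[k] V ⊗[k] V
  braid :
    c.toLinearMap.rTensor V ∘ₗ
        ((TensorProduct.assoc k V V V).symm.toLinearMap ∘ₗ c.toLinearMap.lTensor V ∘ₗ
          (TensorProduct.assoc k V V V).toLinearMap) ∘ₗ c.toLinearMap.rTensor V =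
      ((TensorProduct.assoc k V V V).symm.toLinearMap ∘ₗ c.toLinearMap.lTensor V ∘ₗ
          (TensorProduct.assoc k V V V).toLinearMap) ∘ₗ c.toLinearMap.rTensor V ∘ₗ
        ((TensorProduct.assoc k V V V).symm.toLinearMap ∘ₗ c.toLinearMap.lTensor V ∘ₗ
          (TensorProduct.assoc k V V V).toLinearMap)

section KernelIsIdeal

variable {k V : Type*} [Field k] [AddCommGroup V] [Module k V]

theorem snocEquiv_tprod (n : ℕ) (f : Fin n → V) (v : V) :
    snocEquiv k V n (PiTensorProduct.tprod k f ⊗ₜ v) =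
      PiTensorProduct.tprod k (Fin.snoc f v : Fin (n + 1) → V) := by
  have h : snocEquiv k V n (PiTensorProduct.tprod k f ⊗ₜ v) =
      TensorPower.mulEquiv ((PiTensorProduct.tprod k f) ⊗ₜ
        (PiTensorProduct.subsingletonEquiv (R := k) (0 : Fin 1)).symm v) := rfl
  rw [h, PiTensorProduct.subsingletonEquiv_symm_apply, ← TensorPower.gMul_def,
    TensorPower.tprod_mul_tprod, Fin.append_right_eq_snoc]
  simp [Function.update_self]

theorem toTensorAlgebra_snoc (n : ℕ) (t : ⨂[k]^n V) (v : V) :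
    TensorPower.toTensorAlgebra (snocEquiv k V n (t ⊗ₜ v)) =
      TensorPower.toTensorAlgebra t * TensorAlgebra.ι k v := by
  have h : snocEquiv k V n (t ⊗ₜ v) =
      TensorPower.mulEquiv (t ⊗ₜ
        (PiTensorProduct.subsingletonEquiv (R := k) (0 : Fin 1)).symm v) := rfl
  rw [h, ← TensorPower.gMul_def, TensorPower.toTensorAlgebra_gMul,
    PiTensorProduct.subsingletonEquiv_symm_apply, TensorPower.toTensorAlgebra_tprod]
  simp [TensorAlgebra.tprod_apply]

theorem snoc_ext {n : ℕ} {W : Type*} [AddCommGroup W] [Module k W]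
    {f g : (⨂[k]^(n + 1) V) →ₗ[k] W}
    (h : ∀ t v, f (snocEquiv k V n (t ⊗ₜ v)) = g (snocEquiv k V n (t ⊗ₜ v))) : f = g := by
  have : f ∘ₗ (snocEquiv k V n).toLinearMap = g ∘ₗ (snocEquiv k V n).toLinearMap :=
    TensorProduct.ext' h
  ext1
  ext x
  obtain ⟨y, hy⟩ := (snocEquiv k V n).surjective (PiTensorProduct.tprod k x)
  have := LinearMap.congr_fun this y
  simpa [hy] using this

theorem tensorId_snoc {n m : ℕ} (f : (⨂[k]^n V) →ₗ[k] ⨂[k]^m V) (t : ⨂[k]^n V) (v : V) :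
    tensorId f (snocEquiv k V n (t ⊗ₜ v)) = snocEquiv k V m (f t ⊗ₜ v) := by
  simp [tensorId]

theorem tensorId_comp {n m l : ℕ} (g : (⨂[k]^m V) →ₗ[k] ⨂[k]^l V)
    (f : (⨂[k]^n V) →ₗ[k] ⨂[k]^m V) : tensorId (g ∘ₗ f) = tensorId g ∘ₗ tensorId f :=
  snoc_ext fun t v => by simp [tensorId_snoc]

theorem tensorId_add {n m : ℕ} (g f : (⨂[k]^n V) →ₗ[k] ⨂[k]^m V) :
    tensorId (g + f) = tensorId g + tensorId f :=
  snoc_ext fun t v => by simp [tensorId_snoc, TensorProduct.add_tmul]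

theorem tensorId_id {n : ℕ} :
    tensorId (LinearMap.id : (⨂[k]^n V) →ₗ[k] ⨂[k]^n V) = LinearMap.id :=
  snoc_ext fun t v => by simp [tensorId_snoc]

theorem applyLast_snocTwo (c : V ⊗[k] V →ₗ[k] V ⊗[k] V) (n : ℕ) (t : ⨂[k]^n V)
    (w : V ⊗[k] V) :
    applyLast c n (snocTwoEquiv k V n (t ⊗ₜ w)) = snocTwoEquiv k V n (t ⊗ₜ c w) := by
  simp [applyLast]

theorem snocTwo_tmul (n : ℕ) (t : ⨂[k]^n V) (v w : V) :
    snocTwoEquiv k V n (t ⊗ₜ (v ⊗ₜ w)) =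
      snocEquiv k V (n + 1) (snocEquiv k V n (t ⊗ₜ v) ⊗ₜ w) := by
  simp [snocTwoEquiv]

theorem tensorId_tensorId_snocTwo {n m : ℕ} (f : (⨂[k]^n V) →ₗ[k] ⨂[k]^m V) (t : ⨂[k]^n V)
    (w : V ⊗[k] V) :
    tensorId (tensorId f) (snocTwoEquiv k V n (t ⊗ₜ w)) = snocTwoEquiv k V m (f t ⊗ₜ w) := by
  induction w with
  | zero => simp
  | tmul x y => simp [snocTwo_tmul, tensorId_snoc]
  | add x y hx hy => simp only [TensorProduct.tmul_add, map_add, hx, hy]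

theorem applyLast_comm (c : V ⊗[k] V →ₗ[k] V ⊗[k] V) {n m : ℕ}
    (f : (⨂[k]^n V) →ₗ[k] ⨂[k]^m V) :
    applyLast c m ∘ₗ tensorId (tensorId f) = tensorId (tensorId f) ∘ₗ applyLast c n := by
  refine LinearMap.ext fun x => ?_
  obtain ⟨y, rfl⟩ := (snocTwoEquiv k V n).surjective x
  induction y with
  | zero => simp
  | tmul t w =>
    simp only [LinearMap.comp_apply, applyLast_snocTwo, tensorId_tensorId_snocTwo]
  | add x y hx hy => simp only [map_add, hx, hy]

/-- Concatenation `V^{⊗n} ⊗ ((V ⊗ V) ⊗ V) → V^{⊗(n+3)}` with the first argument fixed. -/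
def snocThree (n : ℕ) (t : ⨂[k]^n V) : (V ⊗[k] V) ⊗[k] V →ₗ[k] ⨂[k]^(n + 3) V :=
  (snocEquiv k V (n + 2)).toLinearMap ∘ₗ
    ((snocTwoEquiv k V n).toLinearMap ∘ₗ TensorProduct.mk k _ _ t).rTensor V

theorem snocThree_tmul (n : ℕ) (t : ⨂[k]^n V) (w : V ⊗[k] V) (v : V) :
    snocThree n t (w ⊗ₜ v) = snocEquiv k V (n + 2) (snocTwoEquiv k V n (t ⊗ₜ w) ⊗ₜ v) := rfl

theorem snocThree_assoc_symm (n : ℕ) (t : ⨂[k]^n V) (v : V) (w : V ⊗[k] V) :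
    snocThree n t ((TensorProduct.assoc k V V V).symm (v ⊗ₜ w)) =
      snocTwoEquiv k V (n + 1) (snocEquiv k V n (t ⊗ₜ v) ⊗ₜ w) := by
  induction w with
  | zero => simp
  | tmul x y => simp [snocThree_tmul, snocTwo_tmul]
  | add x y hx hy => simp only [TensorProduct.tmul_add, map_add, hx, hy]

theorem tensorId_applyLast_snocThree (c : V ⊗[k] V →ₗ[k] V ⊗[k] V) (n : ℕ) (t : ⨂[k]^n V)
    (x : (V ⊗[k] V) ⊗[k] V) :
    tensorId (applyLast c n) (snocThree n t x) = snocThree n t (c.rTensor V x) := by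
  induction x with
  | zero => simp
  | tmul w v => simp [snocThree_tmul, tensorId_snoc, applyLast_snocTwo]
  | add x y hx hy => simp only [map_add, hx, hy]

theorem applyLast_snocThree (c : V ⊗[k] V →ₗ[k] V ⊗[k] V) (n : ℕ) (t : ⨂[k]^n V)
    (x : (V ⊗[k] V) ⊗[k] V) :
    applyLast c (n + 1) (snocThree n t x) =
      snocThree n t ((TensorProduct.assoc k V V V).symm
        (c.lTensor V (TensorProduct.assoc k V V V x))) := by
  obtain ⟨y, rfl⟩ := (TensorProduct.assoc k V V V).symm.surjective x
  induction y with
  | zero => simp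
  | tmul v w =>
    rw [snocThree_assoc_symm, applyLast_snocTwo, LinearEquiv.apply_symm_apply,
      LinearMap.lTensor_tmul, snocThree_assoc_symm]
  | add x y hx hy => simp only [map_add, hx, hy]

theorem applyLast_braid (B : Braiding k V) (n : ℕ) :
    applyLast B.c.toLinearMap (n + 1) ∘ₗ tensorId (applyLast B.c.toLinearMap n) ∘ₗ
        applyLast B.c.toLinearMap (n + 1) =
      tensorId (applyLast B.c.toLinearMap n) ∘ₗ applyLast B.c.toLinearMap (n + 1) ∘ₗ
        tensorId (applyLast B.c.toLinearMap n) := by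
  refine snoc_ext fun s v => ?_
  obtain ⟨y, rfl⟩ := (snocTwoEquiv k V n).surjective s
  induction y with
  | zero => simp
  | tmul t w =>
    rw [← snocThree_tmul]
    simp only [LinearMap.comp_apply, tensorId_applyLast_snocThree, applyLast_snocThree]
    have := LinearMap.congr_fun B.braid (w ⊗ₜ[k] v)
    simp only [LinearMap.comp_apply, LinearEquiv.coe_coe] at this
    simp only [this]
  | add x y hx hy => simp only [map_add, TensorProduct.add_tmul, hx, hy]

/-- `t ↦ t ⊗ v`. -/
def snocMap (v : V) (n : ℕ) : (⨂[k]^n V) →ₗ[k] ⨂[k]^(n + 1) V :=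
  (snocEquiv k V n).toLinearMap ∘ₗ (TensorProduct.mk k (⨂[k]^n V) V).flip v

/-- `t ↦ v ⊗ t`. -/
def consMap (v : V) : (n : ℕ) → (⨂[k]^n V) →ₗ[k] ⨂[k]^(n + 1) V
  | 0 => snocMap v 0
  | n + 1 => tensorId (consMap v n)

/-- `t ↦ c_n ⋯ c_1 (v ⊗ t)`. -/
def passMap (c : V ⊗[k] V →ₗ[k] V ⊗[k] V) (v : V) :
    (n : ℕ) → (⨂[k]^n V) →ₗ[k] ⨂[k]^(n + 1) V
  | 0 => snocMap v 0
  | n + 1 => applyLast c n ∘ₗ tensorId (passMap c v n)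

/-- `t ↦ (id + c_1 + c_2 c_1 + ⋯ + c_n ⋯ c_1) (v ⊗ t)`. -/
def leftShuffle (c : V ⊗[k] V →ₗ[k] V ⊗[k] V) (v : V) :
    (n : ℕ) → (⨂[k]^n V) →ₗ[k] ⨂[k]^(n + 1) V
  | 0 => snocMap v 0
  | n + 1 => tensorId (leftShuffle c v n) + passMap c v (n + 1)

theorem passMap_shuffleSum (B : Braiding k V) (v : V) (n : ℕ) :
    passMap B.c.toLinearMap v (n + 1) ∘ₗ shuffleSum B.c.toLinearMap n =
      tensorId (shuffleSum B.c.toLinearMap n) ∘ₗ passMap B.c.toLinearMap v (n + 1) := by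
  induction n with
  | zero => simp [shuffleSum, tensorId_id]
  | succ n ih =>
    set c := B.c.toLinearMap with hc
    have h1 : passMap c v (n + 2) ∘ₗ tensorId (shuffleSum c n) =
        tensorId (tensorId (shuffleSum c n)) ∘ₗ passMap c v (n + 2) := by
      rw [passMap, LinearMap.comp_assoc, ← tensorId_comp, ih, tensorId_comp,
        ← LinearMap.comp_assoc, applyLast_comm, LinearMap.comp_assoc]
    have h2 : passMap c v (n + 2) ∘ₗ applyLast c n =
        tensorId (applyLast c n) ∘ₗ passMap c v (n + 2) := by
      have hb := applyLast_braid B n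
      rw [← hc] at hb
      rw [passMap, passMap, tensorId_comp]
      calc _ = applyLast c (n + 1) ∘ₗ tensorId (applyLast c n) ∘ₗ
                (tensorId (tensorId (passMap c v n)) ∘ₗ applyLast c n) := by
              simp only [LinearMap.comp_assoc]
        _ = (applyLast c (n + 1) ∘ₗ tensorId (applyLast c n) ∘ₗ applyLast c (n + 1)) ∘ₗ
                tensorId (tensorId (passMap c v n)) := by
              rw [← applyLast_comm]; simp only [LinearMap.comp_assoc]
        _ = _ := by rw [hb]; simp only [LinearMap.comp_assoc]
    have h3 : shuffleSum c (n + 1) =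
      LinearMap.id + tensorId (shuffleSum c n) ∘ₗ applyLast c n := rfl
    rw [h3, LinearMap.comp_add, LinearMap.comp_id, ← LinearMap.comp_assoc, h1,
      LinearMap.comp_assoc, h2, tensorId_add, tensorId_id, tensorId_comp, LinearMap.add_comp,
      LinearMap.id_comp, LinearMap.comp_assoc]

theorem shuffleSum_leftShuffle (B : Braiding k V) (v : V) (n : ℕ) :
    shuffleSum B.c.toLinearMap (n + 1) ∘ₗ tensorId (leftShuffle B.c.toLinearMap v n) =
      leftShuffle B.c.toLinearMap v (n + 1) ∘ₗ shuffleSum B.c.toLinearMap n := by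
  induction n with
  | zero =>
    simp [shuffleSum, tensorId_id, leftShuffle, passMap, LinearMap.add_comp]
  | succ n ih =>
    have hp := passMap_shuffleSum B v (n + 1)
    set c := B.c.toLinearMap
    have h3 : ∀ n, shuffleSum c (n + 1) =
      LinearMap.id + tensorId (shuffleSum c n) ∘ₗ applyLast c n := fun _ => rfl
    have h4 : ∀ n, leftShuffle c v (n + 1) =
      tensorId (leftShuffle c v n) + passMap c v (n + 1) := fun _ => rfl
    have h5 : passMap c v (n + 2) = applyLast c (n + 1) ∘ₗ tensorId (passMap c v (n + 1)) := rfl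
    calc _ = tensorId (leftShuffle c v (n + 1)) + tensorId (shuffleSum c (n + 1)) ∘ₗ
              (applyLast c (n + 1) ∘ₗ tensorId (tensorId (leftShuffle c v n)) +
                passMap c v (n + 2)) := by
            rw [h3 (n + 1), LinearMap.add_comp, LinearMap.id_comp, LinearMap.comp_assoc, h5,
              ← LinearMap.comp_add, ← tensorId_add, ← h4]
      _ = tensorId (leftShuffle c v (n + 1)) +
            (tensorId (leftShuffle c v (n + 1)) ∘ₗ tensorId (shuffleSum c n) ∘ₗ applyLast c n +
              passMap c v (n + 2) ∘ₗ shuffleSum c (n + 1)) := by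
            rw [LinearMap.comp_add, applyLast_comm, ← LinearMap.comp_assoc, ← tensorId_comp, ih,
              tensorId_comp, LinearMap.comp_assoc, hp]
      _ = _ := by
            rw [h4 (n + 1), LinearMap.add_comp, ← add_assoc]
            congr 1
            rw [h3 n, LinearMap.comp_add, LinearMap.comp_id]

theorem symmetrizer_consMap (B : Braiding k V) (v : V) (n : ℕ) :
    symmetrizer B.c.toLinearMap (n + 1) ∘ₗ consMap v n =
      leftShuffle B.c.toLinearMap v n ∘ₗ symmetrizer B.c.toLinearMap n := by
  induction n with
  | zero => simp [symmetrizer, shuffleSum, tensorId_id, consMap, leftShuffle]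
  | succ n ih =>
    have h := shuffleSum_leftShuffle B v n
    set c := B.c.toLinearMap
    have h1 : ∀ n, symmetrizer c (n + 1) = shuffleSum c n ∘ₗ tensorId (symmetrizer c n) :=
      fun _ => rfl
    rw [h1 (n + 1), consMap, LinearMap.comp_assoc, ← tensorId_comp, ih, tensorId_comp,
      ← LinearMap.comp_assoc, h, LinearMap.comp_assoc, ← h1]

theorem toTensorAlgebra_consMap (v : V) (n : ℕ) (t : ⨂[k]^n V) :
    TensorPower.toTensorAlgebra (consMap v n t) =
      TensorAlgebra.ι k v * TensorPower.toTensorAlgebra t := by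
  induction n with
  | zero =>
    obtain ⟨r, rfl⟩ := (TensorPower.algebraMap₀ (R := k) (M := V)).surjective t
    have h : consMap v 0 (TensorPower.algebraMap₀ r) =
      snocEquiv k V 0 (TensorPower.algebraMap₀ r ⊗ₜ v) := rfl
    rw [h, toTensorAlgebra_snoc, ← TensorPower.galgebra_toFun_def,
      TensorPower.toTensorAlgebra_galgebra_toFun, Algebra.commutes]
  | succ n ih =>
    suffices TensorPower.toTensorAlgebra ∘ₗ consMap v (n + 1) =
      LinearMap.mulLeft k (TensorAlgebra.ι k v) ∘ₗ TensorPower.toTensorAlgebra from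
        LinearMap.congr_fun this t
    refine snoc_ext fun t u => ?_
    simp only [LinearMap.comp_apply, consMap, tensorId_snoc, toTensorAlgebra_snoc, ih,
      LinearMap.mulLeft_apply, mul_assoc]

theorem totalSymmetrizer_toTensorAlgebra (c : V ⊗[k] V →ₗ[k] V ⊗[k] V) (n : ℕ)
    (t : ⨂[k]^n V) :
    totalSymmetrizer c (TensorPower.toTensorAlgebra t) =
      TensorPower.toTensorAlgebra (symmetrizer c n t) := by
  have h : ∀ s : ⨂[k]^n V, TensorPower.toTensorAlgebra s =
      (TensorAlgebra.equivDirectSum (R := k) (M := V)).symm (DirectSum.lof k ℕ _ n s) := by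
    intro s
    exact (DirectSum.toModule_lof k (M := fun n => ⨂[k]^n V) n s).symm
  rw [h, h]
  simp [totalSymmetrizer, DirectSum.lmap_lof]

theorem tensorAlgebra_ext {W : Type*} [AddCommGroup W] [Module k W]
    {f g : TensorAlgebra k V →ₗ[k] W}
    (h : ∀ n (t : ⨂[k]^n V), f (TensorPower.toTensorAlgebra t) =
      g (TensorPower.toTensorAlgebra t)) : f = g := by
  have h' : f ∘ₗ (TensorAlgebra.equivDirectSum (R := k) (M := V)).symm.toLinearMap =
      g ∘ₗ (TensorAlgebra.equivDirectSum (R := k) (M := V)).symm.toLinearMap := by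
    refine DirectSum.linearMap_ext _ fun n => LinearMap.ext fun t => ?_
    have h2 : (TensorAlgebra.equivDirectSum (R := k) (M := V)).symm (DirectSum.lof k ℕ _ n t) =
      TensorPower.toTensorAlgebra t :=
        DirectSum.toModule_lof k (M := fun n => ⨂[k]^n V) n t
    have := h n t
    rw [← h2] at this
    exact this
  refine LinearMap.ext fun x => ?_
  have := LinearMap.congr_fun h' (TensorAlgebra.equivDirectSum x)
  simpa using this

/-- A family of linear maps `V^{⊗n} → V^{⊗(n+1)}`, as an endomorphism of `T(V)`. -/
def raise (F : (n : ℕ) → (⨂[k]^n V) →ₗ[k] ⨂[k]^(n + 1) V) :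
    TensorAlgebra k V →ₗ[k] TensorAlgebra k V :=
  DirectSum.toModule k ℕ _ (fun n => TensorPower.toTensorAlgebra ∘ₗ F n) ∘ₗ
    (TensorAlgebra.equivDirectSum (R := k) (M := V)).toLinearMap

theorem raise_toTensorAlgebra (F : (n : ℕ) → (⨂[k]^n V) →ₗ[k] ⨂[k]^(n + 1) V) (n : ℕ)
    (t : ⨂[k]^n V) :
    raise F (TensorPower.toTensorAlgebra t) = TensorPower.toTensorAlgebra (F n t) := by
  have h : TensorPower.toTensorAlgebra t =
      (TensorAlgebra.equivDirectSum (R := k) (M := V)).symm (DirectSum.lof k ℕ _ n t) :=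
    (DirectSum.toModule_lof k (M := fun n => ⨂[k]^n V) n t).symm
  rw [h]
  simp [raise]

theorem totalSymmetrizer_mul_ι (c : V ⊗[k] V →ₗ[k] V ⊗[k] V) (v : V) (x : TensorAlgebra k V) :
    totalSymmetrizer c (x * TensorAlgebra.ι k v) =
      raise (fun n => shuffleSum c n ∘ₗ snocMap v n) (totalSymmetrizer c x) := by
  suffices totalSymmetrizer c ∘ₗ LinearMap.mulRight k (TensorAlgebra.ι k v) =
    raise (fun n => shuffleSum c n ∘ₗ snocMap v n) ∘ₗ totalSymmetrizer c from
      LinearMap.congr_fun this x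
  refine tensorAlgebra_ext fun n t => ?_
  simp only [LinearMap.comp_apply, LinearMap.mulRight_apply, totalSymmetrizer_toTensorAlgebra,
    raise_toTensorAlgebra, ← toTensorAlgebra_snoc]
  congr 1
  change shuffleSum c n (tensorId (symmetrizer c n) _) = _
  rw [tensorId_snoc]
  rfl

theorem totalSymmetrizer_ι_mul (B : Braiding k V) (v : V) (x : TensorAlgebra k V) :
    totalSymmetrizer B.c.toLinearMap (TensorAlgebra.ι k v * x) =
      raise (leftShuffle B.c.toLinearMap v) (totalSymmetrizer B.c.toLinearMap x) := by
  suffices totalSymmetrizer B.c.toLinearMap ∘ₗ LinearMap.mulLeft k (TensorAlgebra.ι k v) =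
    raise (leftShuffle B.c.toLinearMap v) ∘ₗ totalSymmetrizer B.c.toLinearMap from
      LinearMap.congr_fun this x
  refine tensorAlgebra_ext fun n t => ?_
  simp only [LinearMap.comp_apply, LinearMap.mulLeft_apply, totalSymmetrizer_toTensorAlgebra,
    raise_toTensorAlgebra, ← toTensorAlgebra_consMap]
  congr 1
  exact LinearMap.congr_fun (symmetrizer_consMap B v n) t

theorem totalSymmetrizer_mul_right (B : Braiding k V) {x : TensorAlgebra k V}
    (y : TensorAlgebra k V) (hx : totalSymmetrizer B.c.toLinearMap x = 0) :
    totalSymmetrizer B.c.toLinearMap (x * y) = 0 := by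
  induction y using TensorAlgebra.induction generalizing x with
  | algebraMap r => rw [← Algebra.commutes, ← Algebra.smul_def, map_smul, hx, smul_zero]
  | ι v => rw [totalSymmetrizer_mul_ι, hx, map_zero]
  | mul a b ha hb => rw [← mul_assoc]; exact hb (ha hx)
  | add a b ha hb => rw [mul_add, map_add, ha hx, hb hx, add_zero]

theorem totalSymmetrizer_mul_left (B : Braiding k V) {x : TensorAlgebra k V}
    (y : TensorAlgebra k V) (hx : totalSymmetrizer B.c.toLinearMap x = 0) :
    totalSymmetrizer B.c.toLinearMap (y * x) = 0 := by
  induction y using TensorAlgebra.induction generalizing x with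
  | algebraMap r => rw [← Algebra.smul_def, map_smul, hx, smul_zero]
  | ι v => rw [totalSymmetrizer_ι_mul, hx, map_zero]
  | mul a b ha hb => rw [mul_assoc]; exact ha (hb hx)
  | add a b ha hb => rw [add_mul, map_add, ha hx, hb hx, add_zero]

end KernelIsIdeal

section Nichols

variable {k V : Type*} [Field k] [AddCommGroup V] [Module k V]

/-- The kernel of the quantum symmetrizer `𝔖`, as a two-sided ideal of `T(V)`. -/
def nicholsIdeal (B : Braiding k V) : TwoSidedIdeal (TensorAlgebra k V) :=
  TwoSidedIdeal.mk' {x | totalSymmetrizer B.c.toLinearMap x = 0}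
    (map_zero _)
    (fun {x y} hx hy => by
      simp only [Set.mem_ofPred_eq] at hx hy ⊢
      rw [map_add, hx, hy, add_zero])
    (fun {x} hx => by
      simp only [Set.mem_ofPred_eq] at hx ⊢
      rw [map_neg, hx, neg_zero])
    (fun {x y} hy => totalSymmetrizer_mul_left B x hy)
    (fun {x y} hx => totalSymmetrizer_mul_right B y hx)

theorem mem_nicholsIdeal (B : Braiding k V) (x : TensorAlgebra k V) :
    x ∈ nicholsIdeal B ↔ totalSymmetrizer B.c.toLinearMap x = 0 :=
  TwoSidedIdeal.mem_mk' _ _ _ _ _ _ _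

/-- The Nichols algebra `𝔅(V) = T(V) / ker 𝔖` of a braided vector space. -/
abbrev NicholsAlgebra (B : Braiding k V) : Type _ :=
  (nicholsIdeal B).ringCon.Quotient

end Nichols

/-- `f × id : X³ → X³`. -/
def onFirstTwo {X : Type*} (f : X × X → X × X) (p : X × X × X) : X × X × X :=
  ((f (p.1, p.2.1)).1, (f (p.1, p.2.1)).2, p.2.2)

/-- `id × f : X³ → X³`. -/
def onLastTwo {X : Type*} (f : X × X → X × X) (p : X × X × X) : X × X × X :=
  (p.1, f p.2)

/-- A set-theoretical solution `(X, r)` of the Yang-Baxter equation. -/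
structure SetSolution (X : Type*) where
  r : X × X ≃ X × X
  yang_baxter : onFirstTwo r ∘ onLastTwo r ∘ onFirstTwo r =
    onLastTwo r ∘ onFirstTwo r ∘ onLastTwo r

namespace SetSolution

variable {X : Type*} (S : SetSolution X)

/-- `r(i, j) = (σ_i(j), τ_j(i))`. -/
def sigma (i j : X) : X := (S.r (i, j)).1

/-- `r(i, j) = (σ_i(j), τ_j(i))`. -/
def tau (j i : X) : X := (S.r (i, j)).2

/-- All the maps `σ_i` and `τ_i` are bijective. -/
structure IsNondegenerate : Prop where
  sigma_bijective : ∀ i, Function.Bijective (S.sigma i)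
  tau_bijective : ∀ i, Function.Bijective (S.tau i)

/-- `r² = id`. -/
def IsInvolutive : Prop := Function.Involutive S.r

variable {S}

/-- The diagonal `D(i) = τ_i⁻¹(i)` of a non-degenerate solution. -/
def IsNondegenerate.diagonal (h : S.IsNondegenerate) (i : X) : X :=
  (Equiv.ofBijective (S.tau i) (h.tau_bijective i)).symm i

theorem IsNondegenerate.tau_diagonal (h : S.IsNondegenerate) (i : X) :
    S.tau i (h.diagonal i) = i :=
  (Equiv.ofBijective (S.tau i) (h.tau_bijective i)).apply_symm_apply i

end SetSolution

/-- Coefficients `R_{i,j} ∈ k^×` satisfying the condition under which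
`c(w_i ⊗ w_j) = R_{i,j} w_{σ_i(j)} ⊗ w_{τ_j(i)}` solves the braid equation. -/
structure BraidingCoeff (k : Type*) [Field k] {X : Type*} (S : SetSolution X) where
  R : X → X → kˣ
  compat : ∀ i j l : X,
    R i j * R (S.tau j i) l * R (S.sigma i j) (S.sigma (S.tau j i) l) =
      R j l * R i (S.sigma j l) * R (S.tau (S.sigma j l) i) (S.tau l j)

section W

variable {k : Type*} [Field k] {X : Type*} {S : SetSolution X}

/-- The basis vector `w_i` of `W_{X,r} = ⨁_{i ∈ X} k w_i`, realized as `X →₀ k`. -/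
def w (k : Type*) [Field k] {X : Type*} (i : X) : X →₀ k := Finsupp.single i 1

/-- The basis `w_i ⊗ w_j` of `W ⊗ W`. -/
def tensorBasis (k : Type*) [Field k] (X : Type*) :
    Module.Basis (X × X) k ((X →₀ k) ⊗[k] (X →₀ k)) :=
  Module.Basis.tensorProduct Finsupp.basisSingleOne Finsupp.basisSingleOne

/-- The linear automorphism `w_i ⊗ w_j ↦ R_{i,j} w_{σ_i(j)} ⊗ w_{τ_j(i)}`. -/
def braidingEquiv (R : BraidingCoeff k S) :
    (X →₀ k) ⊗[k] (X →₀ k) ≃ₗ[k] (X →₀ k) ⊗[k] (X →₀ k) :=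
  (tensorBasis k X).equiv
    (((tensorBasis k X).reindex S.r.symm).unitsSMul (fun p => R.R p.1 p.2)) (Equiv.refl _)

theorem braidingEquiv_apply (R : BraidingCoeff k S) (i j : X) :
    braidingEquiv R (w k i ⊗ₜ w k j) =
      (R.R i j : k) • (w k (S.sigma i j) ⊗ₜ[k] w k (S.tau j i)) := by
  have h : ∀ p : X × X, tensorBasis k X p = w k p.1 ⊗ₜ w k p.2 := fun p => by
    simp [tensorBasis, Module.Basis.tensorProduct_apply', w]
  have := (tensorBasis k X).equiv_apply (i, j)
    (((tensorBasis k X).reindex S.r.symm).unitsSMul (fun p => R.R p.1 p.2)) (Equiv.refl _)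
  rw [h] at this
  refine this.trans ?_
  rw [Equiv.refl_apply, Module.Basis.unitsSMul_apply, Module.Basis.reindex_apply, h]
  rfl

/-- `W_{X,r}` as a braided vector space. -/
def braidingW (R : BraidingCoeff k S) : Braiding k (X →₀ k) where
  c := braidingEquiv R
  braid := by
    refine ((tensorBasis k X).tensorProduct Finsupp.basisSingleOne).ext fun p => ?_
    obtain ⟨⟨i, j⟩, l⟩ := p
    have hb : ((tensorBasis k X).tensorProduct Finsupp.basisSingleOne) ((i, j), l) =
        (w k i ⊗ₜ w k j) ⊗ₜ[k] w k l := by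
      simp [tensorBasis, Module.Basis.tensorProduct_apply', w]
    have hy := congrFun S.yang_baxter (i, j, l)
    have h1 := congrArg (fun p => p.1) hy
    have h2 := congrArg (fun p => p.2.1) hy
    have h3 := congrArg (fun p => p.2.2) hy
    have hR : (R.R i j : k) * R.R (S.tau j i) l * R.R (S.sigma i j) (S.sigma (S.tau j i) l) =
      R.R j l * R.R i (S.sigma j l) * R.R (S.tau (S.sigma j l) i) (S.tau l j) := by
        exact_mod_cast congrArg Units.val (R.compat i j l)
    change S.sigma (S.sigma i j) (S.sigma (S.tau j i) l) = S.sigma i (S.sigma j l) at h1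
    change S.tau (S.sigma (S.tau j i) l) (S.sigma i j) =
      S.sigma (S.tau (S.sigma j l) i) (S.tau l j) at h2
    change S.tau l (S.tau j i) = S.tau (S.tau l j) (S.tau (S.sigma j l) i) at h3
    rw [hb]
    simp only [LinearMap.comp_apply, LinearEquiv.coe_coe, LinearMap.rTensor_tmul,
      LinearMap.lTensor_tmul, TensorProduct.assoc_tmul, TensorProduct.assoc_symm_tmul,
      braidingEquiv_apply, TensorProduct.tmul_smul, ← TensorProduct.smul_tmul', map_smul,
      smul_smul, h1, h2, h3]
    congr 1

/-- The monomial `w_{D^{a-1}(i)} ⋯ w_{D(i)} w_i` of degree `a` in the tensor algebra. -/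
def diagonalWord (k : Type*) [Field k] {X : Type*} (D : X → X) (i : X) :
    ℕ → TensorAlgebra k (X →₀ k)
  | 0 => 1
  | a + 1 => TensorAlgebra.ι k (w k (D^[a] i)) * diagonalWord k D i a

/-- The elements `w_i w_j - R_{i,j} w_{σ_i(j)} w_{τ_j(i)}` with `D(j) ≠ i`. -/
def quadraticRelations (hS : S.IsNondegenerate) (R : BraidingCoeff k S) :
    Set (TensorAlgebra k (X →₀ k)) :=
  {x | ∃ i j : X, hS.diagonal j ≠ i ∧
    x = TensorAlgebra.ι k (w k i) * TensorAlgebra.ι k (w k j) -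
      (R.R i j : k) • (TensorAlgebra.ι k (w k (S.sigma i j)) *
        TensorAlgebra.ι k (w k (S.tau j i)))}

/-- The elements `w_{D^{n-1}(i)} ⋯ w_{D(i)} w_i`. -/
def powerRelations (k : Type*) [Field k] (hS : S.IsNondegenerate) (n : ℕ) :
    Set (TensorAlgebra k (X →₀ k)) :=
  {x | ∃ i : X, x = diagonalWord k hS.diagonal i n}

end W

end NicholsAlg

end

/-! The guitar map turns the solution `r` into the flip. Reading a word from its last letter, it
keeps that letter `j` and applies `τ_j` to the image of the rest; it is a bijection on words, and
when `r² = id`, applying `r` to the last two letters exchanges the corresponding two letters of the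
image (`guitar_swap`). Equal letters in the image correspond to the pairs `(D(j), j)`, which `r`
fixes. So up to scalars the braiding behaves like one of diagonal type with `q_ii = q` and `q_ij
q_ji = 1`, and the Nichols algebra is an analogue of a quantum linear space.

Upper bound: modulo the quadratic relations a monomial depends, up to a scalar, only on the multiset
of letters of its guitar image (`exists_smul_of_guitar_perm`), and the power relations kill it once
a letter occurs `n` times. One word per function `X → Fin n` of multiplicities therefore spans the
quotient.

Lower bound: the symmetrizer preserves these multisets, and if equal letters of the image are
contiguous, the coefficient of the word in its own symmetrization is a product of numbers `1 + q + ⋯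
+ q^a` with `a + 1 < n`, hence nonzero (`symmetrizeWord_apply_self_ne_zero`). So the `n^m`
representatives stay independent in the Nichols algebra. As the relations lie in the kernel of the
symmetrizer, the bounds together give both the dimension and the presentation. -/

namespace NicholsAlg

/-! ### The guitar map of an involutive solution. -/

namespace SetSolution

variable {X : Type*} {S : SetSolution X}

theorem IsInvolutive.tau_tau_sigma (h : S.IsInvolutive) (i j : X) :
    S.tau (S.tau j i) (S.sigma i j) = j :=
  congrArg Prod.snd (h (i, j))

theorem IsInvolutive.sigma_sigma_tau (h : S.IsInvolutive) (i j : X) :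
    S.sigma (S.sigma i j) (S.tau j i) = i :=
  congrArg Prod.fst (h (i, j))

theorem tau_tau (S : SetSolution X) (i j l : X) :
    S.tau l (S.tau j i) = S.tau (S.tau l j) (S.tau (S.sigma j l) i) :=
  congrArg (fun p => p.2.2) (congrFun S.yang_baxter (i, j, l))

theorem IsNondegenerate.tau_eq_iff (h : S.IsNondegenerate) (i j : X) :
    S.tau j i = j ↔ i = h.diagonal j :=
  ⟨fun e => (h.tau_bijective j).1 (e.trans (h.tau_diagonal j).symm),
    fun e => e ▸ h.tau_diagonal j⟩

/-- Involutivity makes `σ_{D(j)}(j)` another preimage of `j` under `τ_j`. With `tau_diagonal` this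
says that `r` fixes `(D(j), j)`. -/
theorem IsNondegenerate.sigma_diagonal (h : S.IsNondegenerate) (hinv : S.IsInvolutive) (j : X) :
    S.sigma (h.diagonal j) j = h.diagonal j := by
  rw [← h.tau_eq_iff]
  have := hinv.tau_tau_sigma (h.diagonal j) j
  rwa [h.tau_diagonal] at this

/-- The permutation `τ_j` of `X`. -/
noncomputable def IsNondegenerate.tauEquiv (h : S.IsNondegenerate) (j : X) : X ≃ X :=
  Equiv.ofBijective (S.tau j) (h.tau_bijective j)

theorem IsNondegenerate.coe_tauEquiv (h : S.IsNondegenerate) (j : X) :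
    ⇑(h.tauEquiv j) = S.tau j := rfl

theorem IsNondegenerate.tauEquiv_symm_self (h : S.IsNondegenerate) (j : X) :
    (h.tauEquiv j).symm j = h.diagonal j := rfl

theorem IsNondegenerate.map_tau_eq_iff (h : S.IsNondegenerate) (j : X) {l l' : List X} :
    l.map (S.tau j) = l' ↔ l = l'.map (h.tauEquiv j).symm := by
  constructor
  · rintro rfl
    simp [← h.coe_tauEquiv]
  · rintro rfl
    simp [← h.coe_tauEquiv]

/-- The guitar map on words. A word is listed from its last letter to its first one, so that
`j :: x` is the word `x` followed by the letter `j`. -/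
def guitar (S : SetSolution X) : List X → List X
  | [] => []
  | j :: x => j :: (S.guitar x).map (S.tau j)

theorem guitar_cons (j : X) (x : List X) :
    S.guitar (j :: x) = j :: (S.guitar x).map (S.tau j) := rfl

theorem guitar_eq_nil {x : List X} : S.guitar x = [] ↔ x = [] := by
  cases x <;> simp [guitar]

theorem IsNondegenerate.guitar_injective (h : S.IsNondegenerate) :
    Function.Injective S.guitar := by
  intro x
  induction x with
  | nil => intro y hy; exact (guitar_eq_nil.1 hy.symm).symm
  | cons j x ih =>
    rintro (_ | ⟨i, y⟩) hy
    · simp [guitar] at hy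
    · simp only [guitar, List.cons.injEq] at hy
      obtain ⟨rfl, hy⟩ := hy
      rw [ih (List.map_injective_iff.2 (h.tau_bijective j).1 hy)]

theorem IsNondegenerate.guitar_surjective (h : S.IsNondegenerate) :
    Function.Surjective S.guitar := by
  -- Removing the letter `j` leaves an image twisted by `τ_j⁻¹`, so the induction must allow an
  -- arbitrary relabelling `g`.
  suffices ∀ (y : List X) (g : X ≃ X), ∃ x, S.guitar x = y.map g from
    fun y => by simpa using this y (Equiv.refl X)
  intro y
  induction y with
  | nil => exact fun g => ⟨[], rfl⟩
  | cons j y ih =>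
    intro g
    obtain ⟨x, hx⟩ := ih (g.trans (h.tauEquiv (g j)).symm)
    refine ⟨g j :: x, ?_⟩
    rw [guitar_cons, List.map_cons, List.cons.injEq, h.map_tau_eq_iff, hx]
    simp

theorem guitar_cons_cons (S : SetSolution X) (j i : X) (x : List X) :
    S.guitar (j :: i :: x) =
      j :: S.tau j i :: ((S.guitar x).map (fun a => S.tau j (S.tau i a))) := by
  simp [guitar, Function.comp_def]

/-- Compare with `guitar_cons_cons`: the first two letters are exchanged. The tails agree because
the third component of the Yang–Baxter equation gives `τ_j τ_i = τ_{τ_j(i)} τ_{σ_i(j)}`. -/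
theorem IsInvolutive.guitar_swap (hinv : S.IsInvolutive) (j i : X) (x : List X) :
    S.guitar (S.tau j i :: S.sigma i j :: x) =
      S.tau j i :: j :: ((S.guitar x).map (fun a => S.tau j (S.tau i a))) := by
  rw [guitar_cons_cons, hinv.tau_tau_sigma]
  simp only [S.tau_tau _ i j]

end SetSolution

/-! ### Coefficients of the quantum symmetrizer on words. -/

section Words

variable {k : Type*} [Field k] {X : Type*} {S : SetSolution X}

/-- The effect of `𝔖_{n,1}` on the word `j :: x`, with words listed from the last letter. -/
noncomputable def shuffleWord (R : BraidingCoeff k S) : X → List X → (List X →₀ k)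
  | j, [] => Finsupp.single [j] 1
  | j, i :: x => Finsupp.single (j :: i :: x) 1 +
      (R.R i j : k) • (shuffleWord R (S.sigma i j) x).mapDomain (List.cons (S.tau j i))

/-- The effect of `𝔖` on a word, with words listed from the last letter. -/
noncomputable def symmetrizeWord (R : BraidingCoeff k S) : List X → (List X →₀ k)
  | [] => Finsupp.single [] 1
  | j :: x => Finsupp.linearCombination k (shuffleWord R j) (symmetrizeWord R x)

theorem mapDomain_cons_nil (j : X) (f : List X →₀ k) :
    f.mapDomain (List.cons j) [] = 0 :=
  Finsupp.mapDomain_of_notMem_range _ _ (by simp)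

theorem mapDomain_cons_cons (j : X) (f : List X →₀ k) (x : List X) :
    f.mapDomain (List.cons j) (j :: x) = f x :=
  Finsupp.mapDomain_apply List.cons_injective _ _

theorem mapDomain_cons_of_ne {i j : X} (h : i ≠ j) (f : List X →₀ k) (x : List X) :
    f.mapDomain (List.cons i) (j :: x) = 0 :=
  Finsupp.mapDomain_of_notMem_range _ _ (by simp [h])

/-- Each summand arises by successive applications of `r` to neighbouring letters, and by
`guitar_swap` each of these only transposes two letters of the guitar image. -/
theorem guitar_perm_of_shuffleWord_ne_zero (hinv : S.IsInvolutive) (R : BraidingCoeff k S)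
    (j : X) (y z : List X) (hz : shuffleWord R j y z ≠ 0) :
    (S.guitar z).Perm (S.guitar (j :: y)) := by
  induction y generalizing j z with
  | nil =>
    have : z = [j] := by
      by_contra h
      exact hz (Finsupp.single_eq_of_ne h)
    rw [this]
  | cons i y ih =>
    by_cases h : z = j :: i :: y
    · rw [h]
    · rw [shuffleWord, Finsupp.add_apply, Finsupp.single_eq_of_ne h, zero_add,
        Finsupp.smul_apply, smul_eq_mul] at hz
      have hz := right_ne_zero_of_mul hz
      cases z with
      | nil => exact absurd (mapDomain_cons_nil _ _) hz
      | cons l z =>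
        by_cases hl : S.tau j i = l
        · subst hl
          rw [mapDomain_cons_cons] at hz
          refine (((ih _ _ hz).map (S.tau (S.tau j i))).cons (S.tau j i)).trans ?_
          rw [← SetSolution.guitar_cons, hinv.guitar_swap, S.guitar_cons_cons]
          exact List.Perm.swap _ _ _
        · exact absurd (mapDomain_cons_of_ne hl _ _) hz

theorem guitar_perm_of_symmetrizeWord_ne_zero (hinv : S.IsInvolutive) (R : BraidingCoeff k S)
    (x z : List X) (hz : symmetrizeWord R x z ≠ 0) :
    (S.guitar z).Perm (S.guitar x) := by
  induction x generalizing z with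
  | nil =>
    have : z = [] := by
      by_contra h
      exact hz (Finsupp.single_eq_of_ne h)
    rw [this]
  | cons j x ih =>
    rw [symmetrizeWord, Finsupp.linearCombination_apply, Finsupp.sum, Finsupp.finsetSum_apply] at hz
    obtain ⟨y, -, hy⟩ := Finset.exists_ne_zero_of_sum_ne_zero hz
    rw [Finsupp.smul_apply, smul_eq_mul] at hy
    refine (guitar_perm_of_shuffleWord_ne_zero hinv R j y z (right_ne_zero_of_mul hy)).trans ?_
    exact ((ih y (left_ne_zero_of_mul hy)).map _).cons _

variable (hnd : S.IsNondegenerate) (hinv : S.IsInvolutive) (R : BraidingCoeff k S) {q : k}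
  (hRq : ∀ i : X, (R.R (hnd.diagonal i) i : k) = q)

include hinv hRq

/-- A constant guitar image means that the word ends in the fixed pair `(D(j), j)`, and likewise at
each earlier place. The word is thus an eigenvector, with eigenvalue given by `[a+2]_q = 1 + q
[a+1]_q`. -/
theorem shuffleWord_replicate (a : ℕ) (j : X) (y : List X)
    (hy : S.guitar (j :: y) = List.replicate (a + 1) j) :
    shuffleWord R j y = Finsupp.single (j :: y) (∑ i ∈ Finset.range (a + 1), q ^ i) := by
  induction a generalizing j y with
  | zero =>
    obtain rfl : y = [] := by simpa [SetSolution.guitar, SetSolution.guitar_eq_nil] using hy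
    simp [shuffleWord]
  | succ a ih =>
    rw [SetSolution.guitar_cons, List.replicate_succ, List.cons.injEq, hnd.map_tau_eq_iff,
      List.map_replicate, hnd.tauEquiv_symm_self] at hy
    cases y with
    | nil => simp [SetSolution.guitar, List.replicate_succ] at hy
    | cons i y =>
      have h := hy.2
      rw [List.replicate_succ, SetSolution.guitar_cons, List.cons.injEq] at h
      have hi := h.1
      have h2 := hy.2
      subst hi
      rw [shuffleWord, hnd.sigma_diagonal hinv, hnd.tau_diagonal, ih _ _ h2, hRq,
        geom_sum_succ (n := a + 1), Finsupp.mapDomain_single, Finsupp.smul_single, ← Finsupp.single_add, smul_eq_mul,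
        add_comm]

theorem symmetrizeWord_replicate (a : ℕ) (j : X) (x : List X)
    (hx : S.guitar x = List.replicate a j) :
    symmetrizeWord R x =
      Finsupp.single x (∏ b ∈ Finset.range a, ∑ i ∈ Finset.range (b + 1), q ^ i) := by
  induction a generalizing j x with
  | zero =>
    obtain rfl : x = [] := by simpa [SetSolution.guitar_eq_nil] using hx
    simp [symmetrizeWord]
  | succ a ih =>
    cases x with
    | nil => simp [SetSolution.guitar, List.replicate_succ] at hx
    | cons i x =>
      have h := hx
      rw [List.replicate_succ, SetSolution.guitar_cons, List.cons.injEq, hnd.map_tau_eq_iff,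
        List.map_replicate] at h
      obtain ⟨rfl, h⟩ := h
      rw [symmetrizeWord, ih _ _ h, Finsupp.linearCombination_single,
        shuffleWord_replicate hnd hinv R hRq a i x hx, Finsupp.smul_single, smul_eq_mul,
        Finset.prod_range_succ]

/-- Here `j :: x` has guitar image `j^{a+1} z`. A summand other than the identity can end in `j`
only if `τ_j(i) = j`, that is `i = D(j)`; then the braiding only contributes `q` and the question
recurs one letter earlier. The coefficient vanishes for `y ≠ x`, so a single term survives when
symmetrizing. -/
theorem shuffleWord_apply_cons (a : ℕ) (z : List X) (j : X) (x y : List X)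
    (hx : (S.guitar x).map (S.tau j) = List.replicate a j ++ z) (hz : j ∉ z) :
    shuffleWord R j y (j :: x) =
      Finsupp.single y (∑ i ∈ Finset.range (a + 1), q ^ i) x := by
  induction y generalizing a z j x with
  | nil =>
    cases x with
    | nil =>
      obtain rfl : a = 0 := by simp [SetSolution.guitar] at hx; exact hx.1
      simp [shuffleWord]
    | cons i x =>
      rw [shuffleWord, Finsupp.single_eq_of_ne (by simp), Finsupp.single_eq_of_ne (by simp)]
  | cons i y ih =>
    rw [shuffleWord, Finsupp.add_apply, Finsupp.smul_apply, smul_eq_mul]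
    have h1 : (Finsupp.single (j :: i :: y) (1 : k)) (j :: x) =
        Finsupp.single (i :: y) (1 : k) x := by
      classical
      simp [Finsupp.single_apply]
    rw [h1]
    by_cases hij : S.tau j i = j
    · have hi := (hnd.tau_eq_iff i j).1 hij
      rw [hij, mapDomain_cons_cons]
      rw [hnd.map_tau_eq_iff, List.map_append, List.map_replicate, hnd.tauEquiv_symm_self,
        ← hi] at hx
      have hz' : i ∉ z.map (hnd.tauEquiv j).symm := by
        rw [hi, ← hnd.tauEquiv_symm_self]
        simpa using hz
      have hs : S.sigma i j = i := by rw [hi]; exact hnd.sigma_diagonal hinv j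
      have hR : (R.R i j : k) = q := by rw [hi]; exact hRq j
      rw [hs, hR]
      cases a with
      | zero =>
        have hx' : i ∉ S.guitar x := by rw [hx]; simpa using hz'
        have hne : x ≠ i :: y := by
          rintro rfl
          simp [SetSolution.guitar] at hx'
        -- The guitar image of any word in the support of `shuffleWord R i y` contains `i`, while
        -- that of `x` does not.
        rw [Finsupp.single_eq_of_ne hne, Finsupp.single_eq_of_ne hne, zero_add]
        by_contra h
        have := guitar_perm_of_shuffleWord_ne_zero hinv R i y x (right_ne_zero_of_mul h)
        exact hx' (this.mem_iff.2 (by simp [SetSolution.guitar]))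
      | succ a =>
        cases x with
        | nil => simp [SetSolution.guitar, List.replicate_succ] at hx
        | cons i' x =>
          rw [List.replicate_succ, List.cons_append, SetSolution.guitar_cons,
            List.cons.injEq] at hx
          obtain ⟨rfl, hx⟩ := hx
          rw [ih a _ i' x hx hz', geom_sum_succ (n := a + 1)]
          classical
          by_cases hxy : y = x <;> simp [hxy, add_comm]
    · rw [mapDomain_cons_of_ne hij, mul_zero, add_zero]
      by_cases hxy : x = i :: y
      · subst hxy
        have : a = 0 := by
          cases a with
          | zero => rfl
          | succ a => simp [SetSolution.guitar, List.replicate_succ, hij] at hx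
        simp [this]
      · rw [Finsupp.single_eq_of_ne hxy, Finsupp.single_eq_of_ne hxy]

/-! ### Grouped words and their nonzero diagonal coefficients. -/

omit hinv hRq

/-- Words in which equal letters are contiguous and every letter occurs fewer than `n` times. -/
def IsGrouped (n : ℕ) : List X → Prop
  | [] => True
  | j :: l => (∃ a z, a + 1 < n ∧ l = List.replicate a j ++ z ∧ j ∉ z) ∧ IsGrouped n l

theorem IsGrouped.map {n : ℕ} {l : List X} (h : IsGrouped n l) (g : X ≃ X) :
    IsGrouped n (l.map g) := by
  induction l with
  | nil => trivial
  | cons j l ih =>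
    obtain ⟨⟨a, z, ha, rfl, hz⟩, h⟩ := h
    exact ⟨⟨a, z.map g, ha, by simp, by simpa using hz⟩, ih h⟩

theorem IsGrouped.replicate_append {n : ℕ} {l : List X} (h : IsGrouped n l) {j : X} (hj : j ∉ l)
    {a : ℕ} (ha : a < n) : IsGrouped n (List.replicate a j ++ l) := by
  induction a with
  | zero => simpa using h
  | succ a ih => exact ⟨⟨a, l, ha, rfl, hj⟩, ih (by omega)⟩

theorem isGrouped_flatMap {n : ℕ} (f : X → ℕ) (hf : ∀ x, f x < n) {l : List X} (hl : l.Nodup) :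
    IsGrouped n (l.flatMap fun j => List.replicate (f j) j) := by
  induction l with
  | nil => trivial
  | cons j l ih =>
    rw [List.nodup_cons] at hl
    rw [List.flatMap_cons]
    refine (ih hl.2).replicate_append ?_ (hf j)
    intro h
    obtain ⟨i, hi, hij⟩ := List.mem_flatMap.1 h
    exact hl.1 (List.eq_of_mem_replicate hij ▸ hi)

theorem count_flatMap_replicate [DecidableEq X] (f : X → ℕ) {l : List X} (hl : l.Nodup) (i : X) :
    (l.flatMap fun j => List.replicate (f j) j).count i = if i ∈ l then f i else 0 := by
  induction l with
  | nil => simp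
  | cons j l ih =>
    rw [List.nodup_cons] at hl
    rw [List.flatMap_cons, List.count_append, ih hl.2, List.count_replicate]
    by_cases h : i = j
    · subst h; simp [hl.1]
    · simp [h, Ne.symm h]

theorem geom_sum_ne_zero_of_lt {n : ℕ} (hq : IsPrimitiveRoot q n) {a : ℕ} (h0 : 0 < a)
    (ha : a < n) : ∑ i ∈ Finset.range a, q ^ i ≠ 0 := fun h =>
  hq.pow_ne_one_of_pos_of_lt h0.ne' ha (by
    rw [← sub_eq_zero, ← mul_geom_sum, h, mul_zero])

include hinv hRq

theorem symmetrizeWord_apply_self_ne_zero {n : ℕ} (hq : IsPrimitiveRoot q n) (x : List X)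
    (hx : IsGrouped n (S.guitar x)) : symmetrizeWord R x x ≠ 0 := by
  induction x with
  | nil => simp [symmetrizeWord]
  | cons j x ih =>
    obtain ⟨⟨a, z, ha, hl, hz⟩, h⟩ := hx
    -- Being grouped is invariant under relabelling, so the twist by `τ_j` can be undone.
    have ih := ih (by
      have := h.map (hnd.tauEquiv j).symm
      rwa [← hnd.map_tau_eq_iff j |>.1 rfl] at this)
    rw [symmetrizeWord, Finsupp.linearCombination_apply, Finsupp.sum, Finsupp.finsetSum_apply,
      Finset.sum_eq_single x]
    · rw [Finsupp.smul_apply, smul_eq_mul, shuffleWord_apply_cons hnd hinv R hRq a z j x x hl hz,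
        Finsupp.single_eq_same]
      exact mul_ne_zero ih (geom_sum_ne_zero_of_lt hq a.succ_pos ha)
    · intro y _ hy
      rw [Finsupp.smul_apply, smul_eq_mul, shuffleWord_apply_cons hnd hinv R hRq a z j x y hl hz,
        Finsupp.single_eq_of_ne hy.symm, mul_zero]
    · intro hx
      exact absurd ih (by simpa using hx)

end Words

open scoped TensorProduct

/-! ### Words as tensors and as monomials. -/

section WordVectors

variable {k : Type*} [Field k] {X : Type*} {S : SetSolution X} {V : Type*}
  [AddCommGroup V] [Module k V] (b : Module.Basis X k V)

/-- The tensor `w_{x_n} ⊗ ⋯ ⊗ w_{x_1}` for the word listed as `x_1 :: ⋯ :: x_n`. -/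
noncomputable def wordTensor :
    (x : List X) → ⨂[k]^x.length V
  | [] => TensorPower.algebraMap₀ (1 : k)
  | j :: x => snocEquiv k V x.length (wordTensor x ⊗ₜ b j)

/-- The monomial `w_{x_n} ⋯ w_{x_1}` in the tensor algebra for the word listed as
`x_1 :: ⋯ :: x_n`. -/
noncomputable def wordMonomial :
    List X → TensorAlgebra k V
  | [] => 1
  | j :: x => wordMonomial x * TensorAlgebra.ι k (b j)

theorem toTensorAlgebra_wordTensor (x : List X) :
    TensorPower.toTensorAlgebra (wordTensor b x) = wordMonomial b x := by
  induction x with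
  | nil =>
    rw [wordTensor, ← TensorPower.galgebra_toFun_def,
      TensorPower.toTensorAlgebra_galgebra_toFun, map_one, wordMonomial]
  | cons j x ih =>
    rw [wordMonomial, ← ih]
    exact toTensorAlgebra_snoc _ _ _

theorem wordMonomial_append (x y : List X) :
    wordMonomial b (x ++ y) = wordMonomial b y * wordMonomial b x := by
  induction x with
  | nil => simp [wordMonomial]
  | cons j x ih => rw [List.cons_append, wordMonomial, ih, wordMonomial, mul_assoc]

/-- The word monomials form a basis of the tensor algebra. -/
noncomputable def wordBasis :
    Module.Basis (List X) k (TensorAlgebra k V) :=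
  b.tensorAlgebra.reindex
    ((FreeMonoid.toList (α := X)).trans (Equiv.mk List.reverse List.reverse
      List.reverse_reverse List.reverse_reverse))

/-- The basis `b.tensorAlgebra` reads words from the first letter, which accounts for the reversal.
-/
theorem wordBasis_apply (x : List X) : wordBasis b x = wordMonomial b x := by
  have hb : ∀ y : FreeMonoid X,
      FreeAlgebra.basisFreeMonoid k X y = FreeMonoid.lift (FreeAlgebra.ι k) y := fun y => by
    change MonoidAlgebra.lift k (FreeAlgebra k X) (FreeMonoid X) (FreeMonoid.lift (FreeAlgebra.ι k))
      (MonoidAlgebra.single y 1) = _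
    simp
  have h : ∀ y : List X, b.tensorAlgebra
      (FreeMonoid.ofList y) = wordMonomial b y.reverse := by
    intro y
    induction y with
    | nil =>
      rw [Module.Basis.tensorAlgebra, Module.Basis.map_apply, hb]
      simp [wordMonomial]
    | cons j y ih =>
      rw [List.reverse_cons, wordMonomial_append, ← ih]
      rw [Module.Basis.tensorAlgebra, Module.Basis.map_apply, Module.Basis.map_apply, hb, hb,
        FreeMonoid.ofList_cons, map_mul]
      have := TensorAlgebra.equivFreeAlgebra_symm_ι b j
      simp only [AlgEquiv.toLinearEquiv_apply, map_mul, FreeMonoid.lift_eval_of, this]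
      simp [wordMonomial]
  have := h x.reverse
  rw [List.reverse_reverse] at this
  rw [← this]
  simp [wordBasis]

/-- The braiding `B` acts on the basis `b` by `b_i ⊗ b_j ↦ R_{i,j} b_{σ_i(j)} ⊗ b_{τ_j(i)}`. -/
def IsBraidingBasis (B : Braiding k V) (R : BraidingCoeff k S) : Prop :=
  ∀ i j, B.c (b i ⊗ₜ b j) = (R.R i j : k) • (b (S.sigma i j) ⊗ₜ[k] b (S.tau j i))

variable {b} {B : Braiding k V} {R : BraidingCoeff k S} (hB : IsBraidingBasis b B R)

include hB

/-- `shuffleWord` copies the recursion of `𝔖_{n,1}`: listing words from the last letter puts the two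
factors touched by `c_n` at the head of the list. -/
theorem toTensorAlgebra_shuffleSum (j : X) (x : List X) :
    TensorPower.toTensorAlgebra
        (shuffleSum B.c.toLinearMap x.length (wordTensor b (j :: x))) =
      Finsupp.linearCombination k (wordMonomial b) (shuffleWord R j x) := by
  induction x generalizing j with
  | nil =>
    rw [shuffleWord, Finsupp.linearCombination_single, one_smul]
    exact toTensorAlgebra_wordTensor b [j]
  | cons i x ih =>
    have h1 : wordTensor b (j :: i :: x) = snocTwoEquiv k V x.length
      (wordTensor b x ⊗ₜ (b i ⊗ₜ b j)) := (snocTwo_tmul _ _ _ _).symm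
    have h2 : applyLast B.c.toLinearMap x.length (wordTensor b (j :: i :: x)) =
        (R.R i j : k) • snocEquiv k V (x.length + 1)
          (wordTensor b (S.sigma i j :: x) ⊗ₜ b (S.tau j i)) := by
      rw [h1, applyLast_snocTwo]
      have : B.c.toLinearMap (b i ⊗ₜ b j) =
        (R.R i j : k) • (b (S.sigma i j) ⊗ₜ[k] b (S.tau j i)) := hB i j
      rw [this, TensorProduct.tmul_smul, map_smul, snocTwo_tmul]
      rfl
    have h3 : ∀ (l : X) (f : List X →₀ k),
        Finsupp.linearCombination k (wordMonomial b) (f.mapDomain (List.cons l)) =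
        Finsupp.linearCombination k (wordMonomial b) f * TensorAlgebra.ι k (b l) := by
      intro l f
      rw [Finsupp.linearCombination_mapDomain, Finsupp.linearCombination_apply,
        Finsupp.linearCombination_apply, Finsupp.sum, Finsupp.sum, Finset.sum_mul]
      simp [wordMonomial]
    change TensorPower.toTensorAlgebra (wordTensor b (j :: i :: x) +
      tensorId (shuffleSum B.c.toLinearMap x.length)
        (applyLast B.c.toLinearMap x.length (wordTensor b (j :: i :: x)))) = _
    rw [h2, map_smul, tensorId_snoc, map_add, map_smul, toTensorAlgebra_wordTensor, shuffleWord,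
      map_add, map_smul, h3, ← ih, Finsupp.linearCombination_single, one_smul]
    congr 2
    exact toTensorAlgebra_snoc _ _ _

theorem totalSymmetrizer_wordMonomial (x : List X) :
    totalSymmetrizer B.c.toLinearMap (wordMonomial b x) =
      Finsupp.linearCombination k (wordMonomial b) (symmetrizeWord R x) := by
  induction x with
  | nil =>
    rw [← toTensorAlgebra_wordTensor, totalSymmetrizer_toTensorAlgebra]
    change TensorPower.toTensorAlgebra (wordTensor b []) = _
    rw [toTensorAlgebra_wordTensor, symmetrizeWord, Finsupp.linearCombination_single, one_smul]
  | cons j x ih =>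
    rw [wordMonomial, totalSymmetrizer_mul_ι, ih, symmetrizeWord]
    generalize symmetrizeWord R x = f
    induction f using Finsupp.induction_linear with
    | zero => simp
    | add f g hf hg => rw [map_add, map_add, hf, hg, map_add, map_add]
    | single y c =>
      rw [Finsupp.linearCombination_single, Finsupp.linearCombination_single, map_smul, map_smul,
        ← toTensorAlgebra_shuffleSum hB, ← toTensorAlgebra_wordTensor, raise_toTensorAlgebra]
      rfl

end WordVectors

/-! ### Rewriting by the relations, and the relations in the Nichols ideal. -/

section Relations

variable {k : Type*} [Field k] {X : Type*} {S : SetSolution X} {V : Type*}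
  [AddCommGroup V] [Module k V] (b : Module.Basis X k V)
  (hnd : S.IsNondegenerate) (hinv : S.IsInvolutive) (R : BraidingCoeff k S) {q : k}

/-- The monomial `b_{D^{a-1}(i)} ⋯ b_{D(i)} b_i` of degree `a` in the tensor algebra. -/
noncomputable def basisDiagonalWord (D : X → X) (i : X) : ℕ → TensorAlgebra k V
  | 0 => 1
  | a + 1 => TensorAlgebra.ι k (b (D^[a] i)) * basisDiagonalWord D i a

/-- The elements `b_i b_j - R_{i,j} b_{σ_i(j)} b_{τ_j(i)}` with `D(j) ≠ i`. -/
def basisQuadraticRelations : Set (TensorAlgebra k V) :=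
  {x | ∃ i j : X, hnd.diagonal j ≠ i ∧
    x = TensorAlgebra.ι k (b i) * TensorAlgebra.ι k (b j) -
      (R.R i j : k) • (TensorAlgebra.ι k (b (S.sigma i j)) *
        TensorAlgebra.ι k (b (S.tau j i)))}

/-- The elements `b_{D^{n-1}(i)} ⋯ b_{D(i)} b_i`. -/
def basisPowerRelations (n : ℕ) : Set (TensorAlgebra k V) :=
  {x | ∃ i : X, x = basisDiagonalWord b hnd.diagonal i n}

theorem smul_mem_twoSidedIdeal {A : Type*} [Ring A] [Algebra k A] (I : TwoSidedIdeal A) (c : k)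
    {a : A} (h : a ∈ I) : c • a ∈ I := by
  rw [Algebra.smul_def]
  exact I.mul_mem_left _ _ h

include hinv in
-- A transposition of neighbouring letters in the guitar image is one application of a quadratic
-- relation; a permutation is a chain of these.
theorem exists_smul_of_guitar_perm {I : TwoSidedIdeal (TensorAlgebra k V)}
    (hI : basisQuadraticRelations b hnd R ⊆ I) {x x' : List X}
    (h : (S.guitar x).Perm (S.guitar x')) :
    ∃ u : k, wordMonomial b x - u • wordMonomial b x' ∈ I := by
  suffices ∀ {y y' : List X}, y.Perm y' → ∀ (g : X ≃ X) (x x' : List X), S.guitar x = y.map g →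
      S.guitar x' = y'.map g → ∃ u : k, wordMonomial b x - u • wordMonomial b x' ∈ I from
    this h (Equiv.refl X) x x' (by simp) (by simp)
  intro y y' h
  induction h with
  | nil =>
    intro g x x' hx hx'
    obtain rfl : x = [] := SetSolution.guitar_eq_nil.1 hx
    obtain rfl : x' = [] := SetSolution.guitar_eq_nil.1 hx'
    exact ⟨1, by simp [I.zero_mem]⟩
  | @cons j l l' _ ih =>
    rintro g (_ | ⟨i, x⟩) (_ | ⟨i', x'⟩) hx hx'
    · simp [SetSolution.guitar] at hx
    · simp [SetSolution.guitar] at hx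
    · simp [SetSolution.guitar] at hx'
    rw [SetSolution.guitar_cons, List.map_cons, List.cons.injEq, hnd.map_tau_eq_iff,
      List.map_map] at hx hx'
    obtain ⟨rfl, hx⟩ := hx
    obtain ⟨rfl, hx'⟩ := hx'
    obtain ⟨u, hu⟩ := ih (g.trans (hnd.tauEquiv (g j)).symm) x x' hx hx'
    refine ⟨u, ?_⟩
    have := I.mul_mem_right _ (TensorAlgebra.ι k (b (g j))) hu
    rwa [sub_mul, smul_mul_assoc] at this
  | swap _ _ l =>
    rintro g (_ | ⟨j, _ | ⟨i, x⟩⟩) x' hx hx'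
    · simp [SetSolution.guitar] at hx
    · simp [SetSolution.guitar] at hx
    obtain rfl : x' = S.tau j i :: S.sigma i j :: x := by
      apply hnd.guitar_injective
      rw [hx', hinv.guitar_swap]
      rw [S.guitar_cons_cons] at hx
      simp only [List.map_cons, List.cons.injEq] at hx ⊢
      exact ⟨hx.2.1.symm, hx.1.symm, hx.2.2.symm⟩
    -- For `i = D(j)` the exchanged letters are equal, so the two words coincide and no relation is
    -- needed.
    by_cases hd : hnd.diagonal j = i
    · subst hd
      rw [hnd.tau_diagonal, hnd.sigma_diagonal hinv]
      exact ⟨1, by simp [I.zero_mem]⟩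
    · refine ⟨R.R i j, ?_⟩
      have := I.mul_mem_left (wordMonomial b x) _ (hI ⟨i, j, hd, rfl⟩)
      rwa [mul_sub, mul_smul_comm, ← mul_assoc, ← mul_assoc] at this
  | trans _ _ ih ih' =>
    intro g x x' hx hx'
    rename_i l l' _ _ _
    -- The intermediate list must itself be a guitar image, which is where surjectivity enters.
    obtain ⟨x'', hx''⟩ := hnd.guitar_surjective (l'.map g)
    obtain ⟨u, hu⟩ := ih g x x'' hx hx''
    obtain ⟨v, hv⟩ := ih' g x'' x' hx'' hx'
    refine ⟨u * v, ?_⟩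
    have := I.add_mem hu (smul_mem_twoSidedIdeal I u hv)
    rwa [smul_sub, sub_add_sub_cancel, smul_smul] at this

theorem diagonalWord_mul_ι (D : X → X) (j : X) (a : ℕ) :
    basisDiagonalWord b D (D j) a * TensorAlgebra.ι k (b j) = basisDiagonalWord b D j (a + 1) := by
  induction a with
  | zero => simp [basisDiagonalWord]
  | succ a ih =>
    rw [basisDiagonalWord, mul_assoc, ih, ← Function.iterate_succ_apply]
    rfl

/-- Removing the last letter `j` applies `τ_j⁻¹` to the image, turning the remaining copies of `j`
into copies of `D(j)`; iteration produces the letters `j`, `D(j)`, `D²(j)`, …. -/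
theorem exists_wordMonomial_eq_mul_diagonalWord (a : ℕ) (j : X) (z x : List X)
    (hx : S.guitar x = List.replicate a j ++ z) :
    ∃ y, wordMonomial b x = wordMonomial b y * basisDiagonalWord b hnd.diagonal j a ∧
      (z = [] → y = []) := by
  induction a generalizing j z x with
  | zero => exact ⟨x, by simp [basisDiagonalWord], by
      rintro rfl
      simpa [SetSolution.guitar_eq_nil] using hx⟩
  | succ a ih =>
    cases x with
    | nil => simp [SetSolution.guitar, List.replicate_succ] at hx
    | cons i x =>
      rw [List.replicate_succ, List.cons_append, SetSolution.guitar_cons, List.cons.injEq,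
        hnd.map_tau_eq_iff, List.map_append, List.map_replicate] at hx
      obtain ⟨rfl, hx⟩ := hx
      rw [hnd.tauEquiv_symm_self] at hx
      obtain ⟨y, hy, hy'⟩ := ih _ _ _ hx
      refine ⟨y, ?_, fun h => hy' (by simp [h])⟩
      rw [wordMonomial, hy, mul_assoc, diagonalWord_mul_ι]

include hinv in
-- Rewriting gathers `n` copies of `j` at the head of the guitar image, and the monomial then ends
-- in a power relation.
theorem wordMonomial_mem_of_le_count [DecidableEq X]
    {I : TwoSidedIdeal (TensorAlgebra k V)}
    (hI : basisQuadraticRelations b hnd R ⊆ I) {n : ℕ} (hI' : basisPowerRelations b hnd n ⊆ I)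
    {x : List X} {j : X} (h : n ≤ (S.guitar x).count j) : wordMonomial b x ∈ I := by
  obtain ⟨z, hz⟩ := (List.replicate_sublist_iff.2 h).exists_perm_append
  obtain ⟨x', hx'⟩ := hnd.guitar_surjective (List.replicate n j ++ z)
  obtain ⟨u, hu⟩ := exists_smul_of_guitar_perm b hnd hinv R hI (hx' ▸ hz)
  obtain ⟨y, hy, -⟩ := exists_wordMonomial_eq_mul_diagonalWord b hnd n j z x' hx'
  have h1 : wordMonomial b x' ∈ I := hy ▸ I.mul_mem_left _ _ (hI' ⟨j, rfl⟩)
  have := I.add_mem hu (smul_mem_twoSidedIdeal I u h1)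
  rwa [sub_add_cancel] at this

variable {R} {B : Braiding k V} (hB : IsBraidingBasis b B R)

include hB hinv

/-- In degree two `𝔖 = id + c`, the relation is `(id - c)(b_i ⊗ b_j)`, and `hRR` says that `c²`
fixes `b_i ⊗ b_j`. -/
theorem basisQuadraticRelations_subset_nicholsIdeal
    (hRR : ∀ i j : X, i ≠ hnd.diagonal j → R.R i j * R.R (S.sigma i j) (S.tau j i) = 1) :
    basisQuadraticRelations b hnd R ⊆ nicholsIdeal B := by
  rintro _ ⟨i, j, hij, rfl⟩
  have h : ∀ i j : X, TensorAlgebra.ι k (b i) * TensorAlgebra.ι k (b j) =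
    wordMonomial b [j, i] := fun i j => by simp [wordMonomial]
  have hR : (R.R i j : k) * R.R (S.sigma i j) (S.tau j i) = 1 := by
    rw [← Units.val_mul, hRR i j hij.symm, Units.val_one]
  rw [SetLike.mem_coe, mem_nicholsIdeal, h, h, map_sub, map_smul, totalSymmetrizer_wordMonomial hB,
    totalSymmetrizer_wordMonomial hB]
  simp [symmetrizeWord, shuffleWord, Finsupp.mapDomain_single, hinv.tau_tau_sigma,
    hinv.sigma_sigma_tau, smul_smul, hR]
  abel

theorem basisPowerRelations_subset_nicholsIdeal {n : ℕ} (hn : 2 ≤ n) (hq : IsPrimitiveRoot q n)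
    (hRq : ∀ i : X, (R.R (hnd.diagonal i) i : k) = q) :
    basisPowerRelations b hnd n ⊆ nicholsIdeal B := by
  rintro _ ⟨j, rfl⟩
  obtain ⟨x, hx⟩ := hnd.guitar_surjective (List.replicate n j)
  obtain ⟨y, hy, hy'⟩ :=
    exists_wordMonomial_eq_mul_diagonalWord b hnd n j [] x (by simpa using hx)
  rw [hy' rfl, wordMonomial, one_mul] at hy
  -- The symmetrizer scales this word by a `q`-factorial, whose factor of index `n - 1` is `1 + q +
  -- ⋯ + q^{n-1} = 0`.
  rw [SetLike.mem_coe, mem_nicholsIdeal, ← hy, totalSymmetrizer_wordMonomial hB,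
    symmetrizeWord_replicate hnd hinv R hRq n j x hx, Finset.prod_eq_zero (i := n - 1),
    Finsupp.single_zero, map_zero]
  · simp; omega
  · rw [Nat.sub_add_cancel (by omega)]
    exact hq.geom_sum_eq_zero (by omega)

end Relations

/-! ### Representatives indexed by multiplicities; dimension and presentation. -/

section Representatives

variable {k : Type*} [Field k] {X : Type*} {S : SetSolution X} {V : Type*}
  [AddCommGroup V] [Module k V] (b : Module.Basis X k V)

theorem exists_grouped_word [Fintype X] [DecidableEq X] (hnd : S.IsNondegenerate) {n : ℕ}
    (f : X → Fin n) :
    ∃ x, IsGrouped n (S.guitar x) ∧ ∀ i, (S.guitar x).count i = f i := by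
  obtain ⟨x, hx⟩ := hnd.guitar_surjective
    ((Finset.univ : Finset X).toList.flatMap fun j => List.replicate (f j) j)
  refine ⟨x, hx ▸ isGrouped_flatMap _ (fun i => (f i).2) (Finset.nodup_toList _), fun i => ?_⟩
  rw [hx, count_flatMap_replicate (fun i => (f i : ℕ)) (Finset.nodup_toList _)]
  simp

/-- A word whose image under the guitar map is grouped and has `f i` letters `i`. -/
noncomputable def groupedWord [Fintype X] [DecidableEq X] (hnd : S.IsNondegenerate) {n : ℕ}
    (f : X → Fin n) : List X :=
  (exists_grouped_word hnd f).choose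

variable [Fintype X] [DecidableEq X] (hnd : S.IsNondegenerate) (hinv : S.IsInvolutive)
  (R : BraidingCoeff k S) {q : k} {n : ℕ}

theorem isGrouped_groupedWord (f : X → Fin n) : IsGrouped n (S.guitar (groupedWord hnd f)) :=
  (exists_grouped_word hnd f).choose_spec.1

theorem count_groupedWord (f : X → Fin n) (i : X) :
    (S.guitar (groupedWord hnd f)).count i = f i :=
  (exists_grouped_word hnd f).choose_spec.2 i

/-- The linear combination of the monomials of the grouped words with given coefficients. -/
noncomputable def groupedCombination (n : ℕ) :
    ((X → Fin n) → k) →ₗ[k] TensorAlgebra k V :=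
  Fintype.linearCombination k fun f => wordMonomial b (groupedWord hnd f)

include hinv in
-- The spanning half. It is stated for any ideal containing the relations because it is applied both
-- to the Nichols ideal and to the ideal they generate.
theorem exists_sub_groupedCombination_mem {I : TwoSidedIdeal (TensorAlgebra k V)}
    (hI : basisQuadraticRelations b hnd R ⊆ I) (hI' : basisPowerRelations b hnd n ⊆ I)
    (t : TensorAlgebra k V) : ∃ a, t - groupedCombination b hnd n a ∈ I := by
  rw [← (wordBasis b).linearCombination_repr t]
  generalize (wordBasis b).repr t = f
  induction f using Finsupp.induction_linear with
  | zero => exact ⟨0, by simp [I.zero_mem]⟩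
  | add f g hf hg =>
    obtain ⟨a, ha⟩ := hf
    obtain ⟨a', ha'⟩ := hg
    refine ⟨a + a', ?_⟩
    rw [map_add, map_add, add_sub_add_comm]
    exact I.add_mem ha ha'
  | single x c =>
    rw [Finsupp.linearCombination_single, wordBasis_apply]
    by_cases h : ∃ j, n ≤ (S.guitar x).count j
    · obtain ⟨j, hj⟩ := h
      refine ⟨0, ?_⟩
      rw [map_zero, sub_zero]
      exact smul_mem_twoSidedIdeal I c (wordMonomial_mem_of_le_count b hnd hinv R hI hI' hj)
    · push Not at h
      let f : X → Fin n := fun j => ⟨_, h j⟩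
      have hp : (S.guitar x).Perm (S.guitar (groupedWord hnd f)) :=
        List.perm_iff_count.2 fun i => (count_groupedWord hnd f i).symm
      obtain ⟨u, hu⟩ := exists_smul_of_guitar_perm b hnd hinv R hI hp
      refine ⟨Pi.single f (c * u), ?_⟩
      have := smul_mem_twoSidedIdeal I c hu
      rw [smul_sub, smul_smul] at this
      simpa [groupedCombination, Fintype.linearCombination_apply_single] using this

variable {R} {B : Braiding k V} (hB : IsBraidingBasis b B R)

include hB hinv

/-- Different multiplicities give symmetrizations with disjoint supports, so the coefficient at the
word of `g` isolates `a g` times a nonzero scalar. -/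
theorem eq_zero_of_groupedCombination_mem (hq : IsPrimitiveRoot q n)
    (hRq : ∀ i : X, (R.R (hnd.diagonal i) i : k) = q) {a : (X → Fin n) → k}
    (ha : groupedCombination b hnd n a ∈ nicholsIdeal B) : a = 0 := by
  rw [mem_nicholsIdeal, groupedCombination, Fintype.linearCombination_apply, map_sum] at ha
  simp only [map_smul, totalSymmetrizer_wordMonomial hB] at ha
  simp only [← map_smul, ← map_sum] at ha
  have hli : LinearIndependent k (wordMonomial b) := by
    have := (wordBasis b).linearIndependent
    rwa [show ⇑(wordBasis b) = wordMonomial b from funext (wordBasis_apply b)] at this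
  have h0 := (linearIndependent_iff.1 hli) _ ha
  funext g
  have hg := DFunLike.congr_fun h0 (groupedWord hnd g)
  rw [Finsupp.finsetSum_apply, Finset.sum_eq_single g] at hg
  · exact (mul_eq_zero.1 hg).resolve_right
      (symmetrizeWord_apply_self_ne_zero hnd hinv R hRq hq _ (isGrouped_groupedWord hnd g))
  · intro f _ hf
    rw [Finsupp.smul_apply, smul_eq_mul]
    by_contra h
    have hp := guitar_perm_of_symmetrizeWord_ne_zero hinv R _ _ (right_ne_zero_of_mul h)
    refine hf (funext fun i => Fin.ext ?_)
    rw [← count_groupedWord hnd f i, ← count_groupedWord hnd g i, hp.count_eq]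
  · simp

theorem nicholsAlgebra_finrank_and_presentation (hn : 2 ≤ n) (hq : IsPrimitiveRoot q n)
    (hRq : ∀ i : X, (R.R (hnd.diagonal i) i : k) = q)
    (hRR : ∀ i j : X, i ≠ hnd.diagonal j → R.R i j * R.R (S.sigma i j) (S.tau j i) = 1) :
    (Module.Finite k (NicholsAlgebra B) ∧
      Module.finrank k (NicholsAlgebra B) = n ^ Fintype.card X) ∧
    nicholsIdeal B =
      TwoSidedIdeal.span (basisQuadraticRelations b hnd R ∪ basisPowerRelations b hnd n) := by
  have h2 := basisQuadraticRelations_subset_nicholsIdeal b hnd hinv hB hRR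
  have hp := basisPowerRelations_subset_nicholsIdeal b hnd hinv hB hn hq hRq
  have hle : TwoSidedIdeal.span (basisQuadraticRelations b hnd R ∪
      basisPowerRelations b hnd n) ≤ nicholsIdeal B :=
    TwoSidedIdeal.span_le.2 (Set.union_subset h2 hp)
  refine ⟨?_, le_antisymm (fun t ht => ?_) hle⟩
  · let π := (RingCon.mkₐ k (nicholsIdeal B).ringCon).toLinearMap
    have hπ : ∀ t s, π t = π s ↔ t - s ∈ nicholsIdeal B :=
      fun t s => (RingCon.eq _).trans (TwoSidedIdeal.rel_iff _ _ _)
    let φ := π ∘ₗ groupedCombination b hnd n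
    have hφ : Function.Bijective φ := by
      constructor
      · rw [injective_iff_map_eq_zero]
        intro a ha
        refine eq_zero_of_groupedCombination_mem b hnd hinv hB hq hRq ?_
        have := (hπ _ 0).1 (ha.trans (map_zero π).symm)
        rwa [sub_zero] at this
      · intro y
        obtain ⟨t, rfl⟩ : ∃ t, π t = y := Quotient.exists_rep y
        obtain ⟨a, ha⟩ := exists_sub_groupedCombination_mem b hnd hinv R h2 hp t
        exact ⟨a, ((hπ _ _).2 ha).symm⟩
    let e := LinearEquiv.ofBijective φ hφ
    refine ⟨Module.Finite.equiv e, ?_⟩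
    rw [← e.finrank_eq, Module.finrank_fintype_fun_eq_card]
    simp
  · obtain ⟨a, ha⟩ := exists_sub_groupedCombination_mem b hnd hinv R
      (Set.subset_union_left.trans TwoSidedIdeal.subset_span)
      (Set.subset_union_right.trans TwoSidedIdeal.subset_span) t
    -- Reduced modulo the relations, `t` becomes a combination of representatives that still lies in
    -- the Nichols ideal, hence is zero.
    have h0 := (nicholsIdeal B).sub_mem ht (hle ha)
    rw [sub_sub_cancel] at h0
    rw [eq_zero_of_groupedCombination_mem b hnd hinv hB hq hRq h0, map_zero, sub_zero] at ha
    exact ha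

end Representatives

end NicholsAlg

/-! ### Specialization to the basis `w_i` of `W_{X,r}`. -/

theorem theorem3p18 {k : Type*} [Field k] [IsAlgClosed k] [CharZero k]
    {X : Type*} [Fintype X] (hX : 2 ≤ Fintype.card X)
    (S : NicholsAlg.SetSolution X) (hnd : S.IsNondegenerate) (hinv : S.IsInvolutive)
    (R : NicholsAlg.BraidingCoeff k S) (n : ℕ) (hn : 2 ≤ n) (q : k)
    (hq : IsPrimitiveRoot q n)
    (hRq : ∀ i : X, (R.R (hnd.diagonal i) i : k) = q)
    (hRR : ∀ i j : X, i ≠ hnd.diagonal j →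
      R.R i j * R.R (S.sigma i j) (S.tau j i) = 1) :
    (Module.Finite k (NicholsAlg.NicholsAlgebra (NicholsAlg.braidingW R)) ∧
      Module.finrank k (NicholsAlg.NicholsAlgebra (NicholsAlg.braidingW R)) =
        n ^ Fintype.card X) ∧
    NicholsAlg.nicholsIdeal (NicholsAlg.braidingW R) =
      TwoSidedIdeal.span
        (NicholsAlg.quadraticRelations hnd R ∪ NicholsAlg.powerRelations k hnd n) := by
  classical
  have hb : ∀ i, (Finsupp.basisSingleOne (R := k) (ι := X)) i = NicholsAlg.w k i := fun i => by
    simp [NicholsAlg.w]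
  have hB : NicholsAlg.IsBraidingBasis Finsupp.basisSingleOne (NicholsAlg.braidingW R) R :=
    fun i j => by
      rw [hb, hb, hb, hb]
      exact NicholsAlg.braidingEquiv_apply R i j
  have hQ : NicholsAlg.basisQuadraticRelations Finsupp.basisSingleOne hnd R =
      NicholsAlg.quadraticRelations hnd R := by
    simp only [NicholsAlg.basisQuadraticRelations, NicholsAlg.quadraticRelations, hb]
  have hP : NicholsAlg.basisPowerRelations Finsupp.basisSingleOne hnd n =
      NicholsAlg.powerRelations k hnd n := by
    have hD : ∀ (i : X) (a : ℕ),
        NicholsAlg.basisDiagonalWord (k := k) Finsupp.basisSingleOne hnd.diagonal i a =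
          NicholsAlg.diagonalWord k hnd.diagonal i a := fun i a => by
      induction a with
      | zero => rfl
      | succ a ih =>
        rw [NicholsAlg.basisDiagonalWord, NicholsAlg.diagonalWord, ih, hb]
    simp only [NicholsAlg.basisPowerRelations, NicholsAlg.powerRelations, hD]
  rw [← hQ, ← hP]
  exact NicholsAlg.nicholsAlgebra_finrank_and_presentation _ hnd hinv hB hn hq hRq hRR
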